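/- **Parametric Transversality Theorem.** Let $M$, $N$, $T$ be smooth manifolds (finite-dimensional, Hausdorff, second countable, without boundary) and let $S\subset N$ be an embedded smooth submanifold. A smooth map $f:X\to N$ from a smooth manifold $X$ is called transverse to $S$ if for every $x\in X$ with $f(x)\in S$ one has $T_{f(x)}S+\operatorname{im}(df_x)=T_{f(x)}N$. Let $F:M\times T\to N$ be a smooth map that is transverse to $S$. Then for almost every $t\in T$ the map $F_t:M\to N$, $x\mapsto F(x,t)$, is transverse to $S$; that is, the set of all $t\in T$ for which $F_t$ is not transverse to $S$ has measure zero in $T$, meaning that its image in every smooth chart of $T$ is a Lebesgue null set. -/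

import Mathlib

open scoped Manifold ContDiff Topology

namespace Transversality

section Transverse

variable {EM : Type*} [NormedAddCommGroup EM] [NormedSpace ℝ EM]
  {HM : Type*} [TopologicalSpace HM] (I : ModelWithCorners ℝ EM HM)
  {EN : Type*} [NormedAddCommGroup EN] [NormedSpace ℝ EN]
  {HN : Type*} [TopologicalSpace HN] (J : ModelWithCorners ℝ EN HN)
  {ES : Type*} [NormedAddCommGroup ES] [NormedSpace ℝ ES]
  {HS : Type*} [TopologicalSpace HS] (K : ModelWithCorners ℝ ES HS)
  {M : Type*} [TopologicalSpace M] [ChartedSpace HM M]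
  {N : Type*} [TopologicalSpace N] [ChartedSpace HN N]

/-- The tangent space `T_y S`, seen as a subspace of `T_y N`: the image of the differential at `y`
of the inclusion `S → N`. -/
noncomputable def tangentSubspace (S : Set N) [ChartedSpace HS S] (y : S) :
    Submodule ℝ (TangentSpace J (y : N)) :=
  (mfderiv K J (Subtype.val : S → N) y).range

/-- `f` is transverse to `S` in `x`: if `f x ∈ S`, then `T_{f x} S + im (df_x) = T_{f x} N`. -/
def IsTransverseAt (f : M → N) (S : Set N) [ChartedSpace HS S] (x : M) : Prop :=
  ∀ hx : f x ∈ S, tangentSubspace J K S ⟨f x, hx⟩ ⊔ (mfderiv I J f x).range = ⊤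

/-- `f` is transverse to `S`: it is transverse to `S` in every point. -/
def IsTransverse (f : M → N) (S : Set N) [ChartedSpace HS S] : Prop :=
  ∀ x : M, IsTransverseAt I J K f S x

end Transverse

/-- A subset `A` of a smooth `k`-manifold `T` has measure zero if in every smooth chart its image
is a Lebesgue null set of `ℝ^k`. -/
def HasMeasureZero (k : ℕ) {T : Type*} [TopologicalSpace T]
    [ChartedSpace (EuclideanSpace ℝ (Fin k)) T] (A : Set T) : Prop :=
  ∀ e ∈ IsManifold.maximalAtlas (𝓡 k) ∞ T, MeasureTheory.volume (e '' (e.source ∩ A)) = 0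

/-- The property `p` holds for almost every point of the smooth `k`-manifold `T`. -/
def ForAlmostEvery (k : ℕ) {T : Type*} [TopologicalSpace T]
    [ChartedSpace (EuclideanSpace ℝ (Fin k)) T] (p : T → Prop) : Prop :=
  HasMeasureZero k {t : T | ¬ p t}

end Transversality

/-!
Locally `S` is the zero set of a submersion `q : N → C`, and a map `f` is transverse to `S` at a
point over `S` iff `q ∘ f` is a submersion there. Hence `Z = F⁻¹(S)` is locally the zero set of
the submersion `G = q ∘ F`. For surjective linear maps `g` and `π` out of one space, `π` maps
`ker g` onto its target iff `g` maps `ker π` onto its target. With `g = dG` and `π` the projection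
to `T`, this says that `F_t` is transverse to `S` at `x` iff `(x, t)` is a regular point of the
projection `Z → T`, so the exceptional parameters are critical values and Sard's theorem applies.

For Sard's theorem, let `f` be smooth on an open subset of `E` and induct on `dim E`. Near a point
where `f' ≠ 0`, some linear coordinate of `f` has nonzero derivative, and the claim follows from
the induction hypothesis on the level sets of this coordinate by Fubini. If `f' = 0` and some
higher derivative vanishes but the next one does not, the point lies on a hypersurface cut out by a
component of that derivative, and is critical for the restriction of `f` to it. On the set where
all derivatives up to order `dim E` vanish, `f` is locally Hölder of exponent `dim E + 1`, so the
image of this set has Hausdorff dimension less than one.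
-/

namespace Transversality

open Manifold MeasureTheory Module Set
open scoped NNReal ENNReal

section LinearAlgebra

variable {R V W W' : Type*} [Ring R] [AddCommGroup V] [Module R V] [AddCommGroup W] [Module R W]
  [AddCommGroup W'] [Module R W'] {f : V →ₗ[R] W} {g : V →ₗ[R] W'}

theorem map_eq_top_iff_sup_ker_eq_top (hf : f.range = ⊤) {p : Submodule R V} :
    p.map f = ⊤ ↔ p ⊔ f.ker = ⊤ := by
  rw [← hf, Submodule.map_eq_range_iff, codisjoint_iff]

theorem map_ker_eq_top_comm (hf : f.range = ⊤) (hg : g.range = ⊤) :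
    f.ker.map g = ⊤ ↔ g.ker.map f = ⊤ := by
  rw [map_eq_top_iff_sup_ker_eq_top hf, map_eq_top_iff_sup_ker_eq_top hg, sup_comm]

theorem range_prod_eq_top_of_map_ker_eq_top (hf : f.range = ⊤) (hfg : f.ker.map g = ⊤) :
    (f.prod g).range = ⊤ := by
  have hg : g.range = ⊤ := top_unique (hfg.ge.trans LinearMap.map_le_range)
  rw [LinearMap.range_prod_eq ((map_eq_top_iff_sup_ker_eq_top hg).1 hfg), hf, hg,
    Submodule.prod_top]

end LinearAlgebra

section Dual

variable {E F : Type*} [NormedAddCommGroup E] [NormedSpace ℝ E]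
  [NormedAddCommGroup F] [NormedSpace ℝ F]

theorem exists_dual_range_fderiv_comp_eq_top {f : E → F} {x : E} (hf : DifferentiableAt ℝ f x)
    (hfx : fderiv ℝ f x ≠ 0) : ∃ l : F →L[ℝ] ℝ, (fderiv ℝ (l ∘ f) x).range = ⊤ := by
  obtain ⟨v, hv⟩ := DFunLike.ne_iff.1 hfx
  obtain ⟨l, hl⟩ := SeparatingDual.exists_ne_zero (R := ℝ) hv
  refine ⟨l, ?_⟩
  rw [(l.hasFDerivAt.comp x hf.hasFDerivAt).fderiv]
  exact LinearMap.range_eq_top.2 (LinearMap.surjective fun h ↦ hl (DFunLike.congr_fun h v))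

theorem ker_ne_top_of_range_eq_top [Nontrivial F] {L : E →L[ℝ] F} (hL : L.range = ⊤) :
    L.ker ≠ ⊤ := by
  intro h
  rw [LinearMap.ker_eq_top.1 h, LinearMap.range_zero] at hL
  exact bot_ne_top hL

theorem isOpen_setOf_range_eq_top [FiniteDimensional ℝ F] :
    IsOpen {L : E →L[ℝ] F | L.range = ⊤} := by
  have h : ∀ L : E →L[ℝ] F, L.range = ⊤ ↔ (finrank ℝ F : Cardinal) ≤ L.rank := fun L ↦ by
    rw [LinearMap.rank, ← finrank_eq_rank, Nat.cast_le]
    exact ⟨fun h ↦ by rw [h, finrank_top],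
      fun h ↦ Submodule.eq_top_of_finrank_eq (le_antisymm (Submodule.finrank_le _) h)⟩
  simpa only [h] using isOpen_setOfPred_nat_le_rank (finrank ℝ F)

end Dual

section Straightening

variable {𝕜 : Type*} [RCLike 𝕜] {E : Type*} [NormedAddCommGroup E] [NormedSpace 𝕜 E]
  [CompleteSpace E] {n : WithTop ℕ∞}

theorem contDiffOn_symm_of_isInvertible_fderiv {F : Type*} [NormedAddCommGroup F] [NormedSpace 𝕜 F]
    (φ : OpenPartialHomeomorph E F) (hφ : ContDiffOn 𝕜 n φ φ.source) (hn : n ≠ 0)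
    (hinv : ∀ x ∈ φ.source, (fderiv 𝕜 φ x).IsInvertible) : ContDiffOn 𝕜 n φ.symm φ.target := by
  intro z hz
  have hφz := hφ.contDiffAt (φ.open_source.mem_nhds (φ.map_target hz))
  obtain ⟨e, he⟩ := hinv _ (φ.map_target hz)
  refine (φ.contDiffAt_symm (f₀' := e) hz ?_ hφz).contDiffWithinAt
  exact he ▸ (hφz.differentiableAt hn).hasFDerivAt

variable {G : Type*} [NormedAddCommGroup G] [NormedSpace 𝕜 G] [CompleteSpace G]
  {w : E → G} {U : Set E} {x₀ : E}

theorem exists_openPartialHomeomorph_fst_eq (hU : IsOpen U) (hw : ContDiffOn 𝕜 n w U) (hn : n ≠ 0)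
    (hx₀ : x₀ ∈ U) (hsurj : (fderiv 𝕜 w x₀).range = ⊤)
    (hker : (fderiv 𝕜 w x₀).ker.ClosedComplemented) :
    ∃ φ : OpenPartialHomeomorph E (G × (fderiv 𝕜 w x₀).ker), x₀ ∈ φ.source ∧ φ.source ⊆ U ∧
      (∀ x ∈ φ.source, (φ x).1 = w x) ∧ ContDiffOn 𝕜 n φ φ.source ∧
      ∀ x ∈ φ.source, (fderiv 𝕜 φ x).IsInvertible := by
  set D := (((hw.contDiffAt (hU.mem_nhds hx₀)).hasStrictFDerivAt
    hn).implicitFunctionDataOfComplemented w _ hsurj hker) with hD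
  have hDU : ContDiffOn 𝕜 n D.prodFun U := by
    have : ContDiff 𝕜 n D.rightFun := by
      simp only [hD, HasStrictFDerivAt.implicitFunctionDataOfComplemented]
      fun_prop
    exact hw.prodMk this.contDiffOn
  have hDinv : IsOpen (U ∩ fderiv 𝕜 D.prodFun ⁻¹' {L | L.IsInvertible}) :=
    (hDU.continuousOn_fderiv_of_isOpen hU (ENat.one_le_iff_ne_zero_withTop.2 hn)
      ).isOpen_inter_preimage hU ContinuousLinearEquiv.isOpen
  exact ⟨D.toOpenPartialHomeomorph.restrOpen _ hDinv,
    ⟨D.pt_mem_toOpenPartialHomeomorph_source, hx₀, D.isInvertible_fderiv_prodFun⟩,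
    fun x hx ↦ hx.2.1, fun _ _ ↦ rfl, hDU.mono fun x hx ↦ hx.2.1, fun x hx ↦ hx.2.2⟩

theorem exists_isOpen_forall_exists_fiber_parametrization (hU : IsOpen U)
    (hw : ContDiffOn 𝕜 n w U) (hn : n ≠ 0) (hx₀ : x₀ ∈ U) (hsurj : (fderiv 𝕜 w x₀).range = ⊤)
    (hker : (fderiv 𝕜 w x₀).ker.ClosedComplemented) :
    ∃ O ⊆ U, IsOpen O ∧ x₀ ∈ O ∧ ∀ c, ∃ (V : Set (fderiv 𝕜 w x₀).ker)
      (σ : (fderiv 𝕜 w x₀).ker → E), IsOpen V ∧ ContDiffOn 𝕜 n σ V ∧ σ '' V = O ∩ w ⁻¹' {c} ∧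
        ∀ y ∈ V, (fderiv 𝕜 σ y).range = (fderiv 𝕜 w (σ y)).ker := by
  obtain ⟨φ, hx₀φ, hφU, hφw, hφ, hinv⟩ :=
    exists_openPartialHomeomorph_fst_eq hU hw hn hx₀ hsurj hker
  refine ⟨φ.source, hφU, φ.open_source, hx₀φ, fun c ↦ ⟨{y | (c, y) ∈ φ.target},
    fun y ↦ φ.symm (c, y), φ.open_target.preimage (by fun_prop),
    (contDiffOn_symm_of_isInvertible_fderiv φ hφ hn hinv).comp (by fun_prop) fun y hy ↦ hy,
    ?_, fun y hy ↦ ?_⟩⟩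
  · ext x
    constructor
    · rintro ⟨y, hy, rfl⟩
      exact ⟨φ.map_target hy, by simp [← hφw _ (φ.map_target hy), φ.right_inv hy]⟩
    · rintro ⟨hx, rfl⟩
      have hφx : (w x, (φ x).2) = φ x := Prod.ext (hφw x hx).symm rfl
      exact ⟨(φ x).2, by simpa [hφx] using φ.map_source hx, by simp [hφx, φ.left_inv hx]⟩
  · have hx := φ.map_target hy
    obtain ⟨e, he⟩ := hinv _ hx
    have hφe : HasFDerivAt φ e.toContinuousLinearMap (φ.symm (c, y)) := he ▸
      ((hφ.contDiffAt (φ.open_source.mem_nhds hx)).differentiableAt hn).hasFDerivAt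
    have hw' : HasFDerivAt w (.fst 𝕜 G _ ∘L e.toContinuousLinearMap) (φ.symm (c, y)) :=
      (hasFDerivAt_fst.comp _ hφe).congr_of_eventuallyEq <|
        Filter.mem_of_superset (φ.open_source.mem_nhds hx) fun z hz ↦ (hφw z hz).symm
    have hσ : HasFDerivAt (fun y ↦ φ.symm (c, y)) (e.symm.toContinuousLinearMap ∘L .inr 𝕜 G _) y :=
      (φ.hasFDerivAt_symm hy hφe).comp y (hasFDerivAt_prodMk_right c y)
    rw [hσ.fderiv, hw'.fderiv]
    ext v
    constructor
    · rintro ⟨b, rfl⟩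
      simp
    · intro hv
      exact ⟨(e v).2, e.symm_apply_eq.2 (Prod.ext (Eq.symm hv) rfl)⟩

end Straightening

theorem measure_image_null_of_locally_null {X Y : Type*} [TopologicalSpace X]
    [SecondCountableTopology X] [MeasurableSpace Y] {μ : Measure Y} {f : X → Y} {s : Set X}
    (h : ∀ x ∈ s, ∃ u ∈ 𝓝[s] x, μ (f '' u) = 0) : μ (f '' s) = 0 :=
  measure_null_of_locally_null (μ := OuterMeasure.comap f μ.toOuterMeasure) s h

theorem measure_eq_zero_of_forall_slice {F X Y : Type*}
    [NormedAddCommGroup F] [NormedSpace ℝ F] [MeasurableSpace F] [BorelSpace F]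
    (μ : Measure F) [μ.IsAddHaarMeasure]
    [NormedAddCommGroup X] [NormedSpace ℝ X] [FiniteDimensional ℝ X]
    [NormedAddCommGroup Y] [NormedSpace ℝ Y] [FiniteDimensional ℝ Y]
    [MeasurableSpace Y] [BorelSpace Y] (ν : Measure Y) [ν.IsAddHaarMeasure]
    (e : F ≃L[ℝ] X × Y) {s : Set F} (hs : MeasurableSet s)
    (h : ∀ x, ν {y | e.symm (x, y) ∈ s} = 0) : μ s = 0 := by
  borelize X
  have hes : MeasurableSet (e.symm ⁻¹' s) := e.symm.continuous.measurable hs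
  have hprod : ((Measure.addHaar : Measure X).prod ν) (e.symm ⁻¹' s) = 0 :=
    (Measure.measure_prod_null hes).2 (.of_forall h)
  have := e.isAddHaarMeasure_map μ
  have hmap := Measure.absolutelyContinuous_isAddHaarMeasure (μ.map e) _ hprod
  rwa [Measure.map_apply e.continuous.measurable hes, ← preimage_comp, e.symm_comp_self,
    preimage_id] at hmap

section Flat

variable {E : Type*} [NormedAddCommGroup E] [NormedSpace ℝ E]
  {F : Type*} [NormedAddCommGroup F] [NormedSpace ℝ F] {f : E → F} {k : ℕ}

/-- The points where the derivatives of `f` of order `1, …, k` vanish; the value of `f` is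
unconstrained. -/
def flatSet (f : E → F) (k : ℕ) : Set E :=
  {x | ∀ j, 1 ≤ j → j ≤ k → iteratedFDeriv ℝ j f x = 0}

theorem exists_iteratedFDeriv_eq_zero_of_notMem_flatSet {x : E} (hx : x ∉ flatSet f k)
    (hfx : fderiv ℝ f x = 0) :
    ∃ j, iteratedFDeriv ℝ j f x = 0 ∧ fderiv ℝ (iteratedFDeriv ℝ j f) x ≠ 0 := by
  by_contra! hstep
  refine hx fun j hj _ ↦ ?_
  induction j, hj using Nat.le_induction with
  | base => rw [← norm_eq_zero, norm_iteratedFDeriv_one, hfx, norm_zero]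
  | succ j _ ih =>
    rw [← norm_eq_zero, ← norm_fderiv_iteratedFDeriv, hstep j (ih (by omega)),
      ContinuousLinearMap.opNorm_zero]

theorem norm_sub_le_pow_succ_of_norm_fderiv_le {B : Set E} (hB : Convex ℝ B)
    (hf : ∀ z ∈ B, DifferentiableAt ℝ f z) {x : E} (hx : x ∈ B) {C : ℝ≥0} {i : ℕ}
    (hC : ∀ z ∈ B, ‖fderiv ℝ f z‖ ≤ C * ‖z - x‖ ^ i) {y : E} (hy : y ∈ B) :
    ‖f y - f x‖ ≤ C * ‖y - x‖ ^ (i + 1) := by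
  have hseg : segment ℝ x y ⊆ B := hB.segment_subset hx hy
  rw [pow_succ, ← mul_assoc]
  refine (convex_segment x y).norm_image_sub_le_of_norm_fderiv_le (𝕜 := ℝ)
    (fun z hz ↦ hf z (hseg hz)) (fun z hz ↦ (hC z (hseg hz)).trans ?_)
    (left_mem_segment ℝ x y) (right_mem_segment ℝ x y)
  gcongr
  exact norm_sub_le_of_mem_segment hz

theorem norm_sub_le_of_mem_flatSet {B : Set E} (hB : Convex ℝ B)
    (hf : ∀ z ∈ B, ContDiffAt ℝ (k + 1) f z) {C : ℝ≥0}
    (hC : ∀ z ∈ B, ‖iteratedFDeriv ℝ (k + 1) f z‖ ≤ C) {x : E} (hx : x ∈ B)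
    (hxk : x ∈ flatSet f k) {y : E} (hy : y ∈ B) : ‖f y - f x‖ ≤ C * ‖y - x‖ ^ (k + 1) := by
  have hderiv : ∀ i j, i + j = k → ∀ z ∈ B,
      ‖iteratedFDeriv ℝ (j + 1) f z‖ ≤ C * ‖z - x‖ ^ i := by
    intro i
    induction i with
    | zero =>
      rintro j hj z hz
      obtain rfl : j = k := by omega
      simpa using hC z hz
    | succ i ih =>
      intro j hj z hz
      have hdiff : ∀ z ∈ B, DifferentiableAt ℝ (iteratedFDeriv ℝ (j + 1) f) z := fun z hz ↦
        ((hf z hz).iteratedFDeriv_right (m := 1) (by norm_cast; omega)).differentiableAt one_ne_zero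
      simpa only [hxk (j + 1) (by omega) (by omega), sub_zero] using
        norm_sub_le_pow_succ_of_norm_fderiv_le hB hdiff hx (fun z hz ↦
          (norm_fderiv_iteratedFDeriv (n := j + 1)).trans_le (ih (j + 1) (by omega) z hz)) hz
  exact norm_sub_le_pow_succ_of_norm_fderiv_le hB
    (fun z hz ↦ (hf z hz).differentiableAt (by simp)) hx
    (fun z hz ↦ (norm_iteratedFDeriv_one f).symm.trans_le
      (hderiv k 0 (by omega) z hz)) hy

theorem dimH_image_flatSet_le [FiniteDimensional ℝ E] {U : Set E} (hU : IsOpen U)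
    (hf : ContDiffOn ℝ (k + 1) f U) :
    dimH (f '' (U ∩ flatSet f k)) ≤ finrank ℝ E / ((k + 1 : ℕ) : ℝ≥0) := by
  have hholder : ∀ x ∈ U ∩ flatSet f k, ∃ C : ℝ≥0, ∃ s ∈ 𝓝[U ∩ flatSet f k] x,
      HolderOnWith C ((k + 1 : ℕ) : ℝ≥0) f s := by
    rintro x ⟨hxU, -⟩
    have hcont : ContinuousAt (fun z ↦ ‖iteratedFDeriv ℝ (k + 1) f z‖) x :=
      ((hf.contDiffAt (hU.mem_nhds hxU)).iteratedFDeriv_right (m := 0) (by simp)).continuousAt.norm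
    set C : ℝ≥0 := ‖iteratedFDeriv ℝ (k + 1) f x‖₊ + 1
    obtain ⟨r, hr, hball⟩ := Metric.eventually_nhds_iff_ball.1 ((hU.eventually_mem hxU).and
      (hcont.eventually (eventually_le_nhds (lt_add_one _))))
    refine ⟨C, U ∩ flatSet f k ∩ Metric.ball x r, Filter.inter_mem self_mem_nhdsWithin
      (mem_nhdsWithin_of_mem_nhds (Metric.ball_mem_nhds x hr)), fun a ha b hb ↦ ?_⟩
    have hab := norm_sub_le_of_mem_flatSet (C := C) (convex_ball x r)
      (fun z hz ↦ hf.contDiffAt (hU.mem_nhds (hball z hz).1)) (fun z hz ↦ (hball z hz).2)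
      hb.2 hb.1.2 ha.2
    rw [edist_eq_enorm_sub, edist_eq_enorm_sub, enorm_eq_nnnorm, enorm_eq_nnnorm,
      NNReal.coe_natCast, ENNReal.rpow_natCast]
    exact_mod_cast hab
  refine (dimH_image_le_of_locally_holder_on (by positivity) hholder).trans ?_
  gcongr
  exact (dimH_mono (subset_univ _)).trans_eq (Real.dimH_univ_eq_finrank E)

theorem measure_image_flatSet_eq_zero [FiniteDimensional ℝ E] [FiniteDimensional ℝ F]
    [MeasurableSpace F] [BorelSpace F] (μ : Measure F) [μ.IsAddHaarMeasure] {U : Set E}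
    (hU : IsOpen U) (hf : ContDiffOn ℝ (k + 1) f U) (hk : finrank ℝ E < (k + 1) * finrank ℝ F) :
    μ (f '' (U ∩ flatSet f k)) = 0 := by
  have : (μH[finrank ℝ F] : Measure F).IsAddHaarMeasure := isAddHaarMeasure_hausdorffMeasure
  refine measure_zero_of_dimH_lt (d := finrank ℝ F) ?_
    ((dimH_image_flatSet_le hU hf).trans_lt ?_)
  · simpa using Measure.absolutelyContinuous_isAddHaarMeasure μ μH[finrank ℝ F]
  · rw [ENNReal.div_lt_iff (by simp) (by simp), mul_comm]
    exact_mod_cast hk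

end Flat

theorem range_fderiv_eq_top_of_map_ker_eq_top {E F X Y : Type*}
    [NormedAddCommGroup E] [NormedSpace ℝ E] [NormedAddCommGroup F] [NormedSpace ℝ F]
    [NormedAddCommGroup X] [NormedSpace ℝ X] [NormedAddCommGroup Y] [NormedSpace ℝ Y]
    (e : F ≃L[ℝ] X × Y) {f : E → F} {x : E} (hf : DifferentiableAt ℝ f x)
    (hfst : (fderiv ℝ (fun x ↦ (e (f x)).1) x).range = ⊤)
    (hsnd : (fderiv ℝ (fun x ↦ (e (f x)).1) x).ker.map
      (fderiv ℝ (fun x ↦ (e (f x)).2) x).toLinearMap = ⊤) :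
    (fderiv ℝ f x).range = ⊤ := by
  have hef := e.hasFDerivAt.comp x hf.hasFDerivAt
  have hfst' := (hasFDerivAt_fst.comp x hef).fderiv
  have hsnd' := (hasFDerivAt_snd.comp x hef).fderiv
  have hprod := range_prod_eq_top_of_map_ker_eq_top hfst hsnd
  rw [show fderiv ℝ (fun x ↦ (e (f x)).1) x = _ from hfst',
    show fderiv ℝ (fun x ↦ (e (f x)).2) x = _ from hsnd'] at hprod
  rw [LinearMap.range_eq_top] at hprod ⊢
  exact (EquivLike.comp_surjective _ e).1 hprod

/-- The conclusion of Sard's theorem for smooth maps from open subsets of `E` to `F`: the critical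
values form a null set. Sard's theorem is proved by induction on the dimension of `E`, and this
predicate is the induction hypothesis. -/
def SardProperty (E F : Type*) [NormedAddCommGroup E] [NormedSpace ℝ E]
    [NormedAddCommGroup F] [NormedSpace ℝ F] : Prop :=
  ∀ [MeasurableSpace F] [BorelSpace F] (μ : Measure F) [μ.IsAddHaarMeasure] (f : E → F)
    (U : Set E), IsOpen U → ContDiffOn ℝ ∞ f U → μ (f '' {x ∈ U | (fderiv ℝ f x).range ≠ ⊤}) = 0

section Sard

variable {E F : Type*} [NormedAddCommGroup E] [NormedSpace ℝ E] [FiniteDimensional ℝ E]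
  [NormedAddCommGroup F] [NormedSpace ℝ F] [MeasurableSpace F] [BorelSpace F]
  (μ : Measure F) [μ.IsAddHaarMeasure] {f : E → F} {U : Set E} {x₀ : E}

theorem SardProperty.exists_isOpen_forall_measure_image_fiber_eq_zero {G : Type*}
    [NormedAddCommGroup G] [NormedSpace ℝ G] {w : E → G}
    (sard : SardProperty (fderiv ℝ w x₀).ker F) (hU : IsOpen U) (hf : ContDiffOn ℝ ∞ f U)
    (hw : ContDiffOn ℝ ∞ w U) (hx₀ : x₀ ∈ U) (hsurj : (fderiv ℝ w x₀).range = ⊤) :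
    ∃ O ⊆ U, IsOpen O ∧ x₀ ∈ O ∧ ∀ c, μ (f '' {x ∈ O | w x = c ∧
      (fderiv ℝ w x).ker.map (fderiv ℝ f x).toLinearMap ≠ ⊤}) = 0 := by
  have : FiniteDimensional ℝ G := .of_surjective _ (LinearMap.range_eq_top.1 hsurj)
  have := FiniteDimensional.complete ℝ E
  have := FiniteDimensional.complete ℝ G
  obtain ⟨O, hOU, hO, hx₀O, hfiber⟩ := exists_isOpen_forall_exists_fiber_parametrization hU hw
    (by simp) hx₀ hsurj (fderiv ℝ w x₀).ker_closedComplemented_of_finiteDimensional_range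
  refine ⟨O, hOU, hO, hx₀O, fun c ↦ ?_⟩
  obtain ⟨V, σ, hV, hσ, hσV, hrange⟩ := hfiber c
  have hσU : MapsTo σ V U := fun y hy ↦ hOU (hσV.subset (mem_image_of_mem σ hy)).1
  refine measure_mono_null ?_ (sard μ (f ∘ σ) V hV (hf.comp hσ hσU))
  rintro _ ⟨x, ⟨hxO, hxc, hcrit⟩, rfl⟩
  obtain ⟨y, hy, rfl⟩ := hσV.superset ⟨hxO, hxc⟩
  refine ⟨y, ⟨hy, ?_⟩, rfl⟩
  rwa [fderiv_comp y ((hf.contDiffAt (hU.mem_nhds (hσU hy))).differentiableAt (by simp))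
    ((hσ.contDiffAt (hV.mem_nhds hy)).differentiableAt (by simp)),
    ContinuousLinearMap.toLinearMap_comp, LinearMap.range_comp, hrange y hy]

theorem measure_image_critical_eq_zero_of_regular_zero [Nontrivial F] {V : Type*}
    [NormedAddCommGroup V] [NormedSpace ℝ V] {W : E → V} (hU : IsOpen U) (hf : ContDiffOn ℝ ∞ f U)
    (hW : ContDiffOn ℝ ∞ W U) (IH : ∀ K : Submodule ℝ E, K ≠ ⊤ → SardProperty K F) :
    μ (f '' {x ∈ U | fderiv ℝ f x = 0 ∧ W x = 0 ∧ fderiv ℝ W x ≠ 0}) = 0 := by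
  refine measure_image_null_of_locally_null ?_
  rintro x₀ ⟨hx₀, -, -, hW₀⟩
  obtain ⟨l, hl⟩ := exists_dual_range_fderiv_comp_eq_top
    ((hW.contDiffAt (hU.mem_nhds hx₀)).differentiableAt (by simp)) hW₀
  obtain ⟨O, -, hO, hx₀O, hnull⟩ :=
    SardProperty.exists_isOpen_forall_measure_image_fiber_eq_zero μ
      (IH _ (ker_ne_top_of_range_eq_top hl)) hU hf (l.contDiff.comp_contDiffOn hW) hx₀ hl
  refine ⟨_, inter_mem_nhdsWithin _ (hO.mem_nhds hx₀O), measure_mono_null (image_mono ?_) (hnull 0)⟩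
  rintro x ⟨⟨-, hfx, hWx, -⟩, hxO⟩
  refine ⟨hxO, by simp [hWx], ?_⟩
  rw [hfx, ContinuousLinearMap.toLinearMap_zero, Submodule.map_zero]
  exact bot_ne_top

variable [FiniteDimensional ℝ F]

theorem SardProperty.exists_mem_nhds_measure_image_critical_eq_zero {X Y : Type*}
    [NormedAddCommGroup X] [NormedSpace ℝ X] [FiniteDimensional ℝ X]
    [NormedAddCommGroup Y] [NormedSpace ℝ Y] [FiniteDimensional ℝ Y] (e : F ≃L[ℝ] X × Y)
    (sard : SardProperty (fderiv ℝ (fun x ↦ (e (f x)).1) x₀).ker Y)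
    (hU : IsOpen U) (hf : ContDiffOn ℝ ∞ f U) (hx₀ : x₀ ∈ U)
    (hsurj : (fderiv ℝ (fun x ↦ (e (f x)).1) x₀).range = ⊤) :
    ∃ u ∈ 𝓝 x₀, μ (f '' {x ∈ u | (fderiv ℝ f x).range ≠ ⊤}) = 0 := by
  borelize Y
  have hfst : ContDiffOn ℝ ∞ (fun x ↦ (e (f x)).1) U :=
    contDiff_fst.comp_contDiffOn (e.contDiff.comp_contDiffOn hf)
  have hsnd : ContDiffOn ℝ ∞ (fun x ↦ (e (f x)).2) U :=
    contDiff_snd.comp_contDiffOn (e.contDiff.comp_contDiffOn hf)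
  obtain ⟨O, hOU, hO, hx₀O, hslice⟩ :=
    sard.exists_isOpen_forall_measure_image_fiber_eq_zero .addHaar hU hsnd hfst hx₀ hsurj
  -- Compactness of `B` makes the image measurable, as Fubini requires.
  obtain ⟨B, hB, hx₀B, hBO⟩ := exists_compact_subset
    (((hfst.mono hOU).continuousOn_fderiv_of_isOpen hO (by simp)).isOpen_inter_preimage hO
      isOpen_setOf_range_eq_top) ⟨hx₀O, hsurj⟩
  have hBU : B ⊆ U := fun x hx ↦ hOU (hBO hx).1
  have hcrit : IsCompact {x ∈ B | (fderiv ℝ f x).range ≠ ⊤} :=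
    hB.of_isClosed_subset (((hf.continuousOn_fderiv_of_isOpen hU (by simp)).mono
      hBU).preimage_isClosed_of_isClosed hB.isClosed isOpen_setOf_range_eq_top.isClosed_compl)
      inter_subset_left
  refine ⟨B, mem_interior_iff_mem_nhds.1 hx₀B, measure_eq_zero_of_forall_slice μ .addHaar e
    (hcrit.image_of_continuousOn (hf.continuousOn.mono fun x hx ↦ hBU hx.1)).measurableSet
    fun c ↦ measure_mono_null ?_ (hslice c)⟩
  rintro y ⟨x, ⟨hxB, hxcrit⟩, hxy⟩
  rw [← e.symm_apply_apply (f x), e.symm.injective.eq_iff] at hxy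
  refine ⟨x, ⟨(hBO hxB).1, congrArg Prod.fst hxy, fun htop ↦ hxcrit ?_⟩, congrArg Prod.snd hxy⟩
  exact range_fderiv_eq_top_of_map_ker_eq_top e
    ((hf.contDiffAt (hU.mem_nhds (hBU hxB))).differentiableAt (by simp)) (hBO hxB).2 htop

theorem measure_image_critical_eq_zero_of_fderiv_ne_zero (hU : IsOpen U) (hf : ContDiffOn ℝ ∞ f U)
    (IH : ∀ (K : Submodule ℝ E) (L : Submodule ℝ F), K ≠ ⊤ → SardProperty K L) :
    μ (f '' {x ∈ U | fderiv ℝ f x ≠ 0 ∧ (fderiv ℝ f x).range ≠ ⊤}) = 0 := by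
  refine measure_image_null_of_locally_null ?_
  rintro x₀ ⟨hx₀, hne, -⟩
  have hfx₀ := (hf.contDiffAt (hU.mem_nhds hx₀)).differentiableAt (by simp)
  obtain ⟨l, hl⟩ := exists_dual_range_fderiv_comp_eq_top hfx₀ hne
  have hlsurj : l.range = ⊤ := by
    rw [(l.hasFDerivAt.comp x₀ hfx₀.hasFDerivAt).fderiv] at hl
    exact top_unique (hl.ge.trans (LinearMap.range_comp_le_range _ _))
  obtain ⟨r, hr⟩ := l.exists_rightInverse_of_surjective hlsurj
  obtain ⟨u, hu, hnull⟩ :=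
    SardProperty.exists_mem_nhds_measure_image_critical_eq_zero μ
      (.equivOfRightInverse l r fun t ↦ DFunLike.congr_fun hr t)
      (IH _ l.ker (ker_ne_top_of_range_eq_top hl)) hU hf hx₀ hl
  refine ⟨_, inter_mem_nhdsWithin _ hu, measure_mono_null (image_mono ?_) hnull⟩
  exact fun x hx ↦ ⟨hx.2, hx.1.2.2⟩

end Sard

theorem sardProperty_of_finrank_eq (n : ℕ) : ∀ (E F : Type*)
    [NormedAddCommGroup E] [NormedSpace ℝ E] [FiniteDimensional ℝ E]
    [NormedAddCommGroup F] [NormedSpace ℝ F] [FiniteDimensional ℝ F],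
    finrank ℝ E = n → SardProperty E F := by
  induction n using Nat.strong_induction_on with
  | _ n ih =>
  rintro E F _ _ _ _ _ _ rfl _ _ μ _ f U hU hf
  rcases subsingleton_or_nontrivial F with hF | hF
  · simp [Subsingleton.elim (fderiv ℝ f _).range ⊤]
  have hcrit := measure_image_critical_eq_zero_of_fderiv_ne_zero μ hU hf
    fun K L hK ↦ ih _ (Submodule.finrank_lt hK) K L rfl
  have hzero : ∀ j, μ (f '' {x ∈ U | fderiv ℝ f x = 0 ∧ iteratedFDeriv ℝ j f x = 0 ∧
      fderiv ℝ (iteratedFDeriv ℝ j f) x ≠ 0}) = 0 := fun j ↦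
    measure_image_critical_eq_zero_of_regular_zero μ hU hf (fun x hx ↦
      ((hf.contDiffAt (hU.mem_nhds hx)).iteratedFDeriv_right
        (by exact_mod_cast le_top)).contDiffWithinAt)
      fun K hK ↦ ih _ (Submodule.finrank_lt hK) K F rfl
  have hflat : μ (f '' (U ∩ flatSet f (finrank ℝ E))) = 0 :=
    measure_image_flatSet_eq_zero μ hU (hf.of_le (by exact_mod_cast le_top)) <|
      (Nat.lt_succ_self _).trans_le (Nat.le_mul_of_pos_right _ finrank_pos)
  refine measure_mono_null ?_
    (measure_union_null hcrit (measure_union_null (measure_iUnion_null hzero) hflat))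
  rintro _ ⟨x, ⟨hxU, hx⟩, rfl⟩
  by_cases hfx : fderiv ℝ f x = 0
  swap; · exact .inl ⟨x, ⟨hxU, hfx, hx⟩, rfl⟩
  by_cases hflatx : x ∈ flatSet f (finrank ℝ E)
  · exact .inr (.inr ⟨x, ⟨hxU, hflatx⟩, rfl⟩)
  · obtain ⟨j, hj⟩ := exists_iteratedFDeriv_eq_zero_of_notMem_flatSet hflatx hfx
    exact .inr (.inl (mem_iUnion.2 ⟨j, x, ⟨hxU, hfx, hj⟩, rfl⟩))

theorem sardProperty (E F : Type*)
    [NormedAddCommGroup E] [NormedSpace ℝ E] [FiniteDimensional ℝ E]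
    [NormedAddCommGroup F] [NormedSpace ℝ F] [FiniteDimensional ℝ F] : SardProperty E F :=
  sardProperty_of_finrank_eq _ E F rfl

section Parametric

variable {P Q C : Type*} [NormedAddCommGroup P] [NormedSpace ℝ P] [FiniteDimensional ℝ P]
  [NormedAddCommGroup Q] [NormedSpace ℝ Q] [FiniteDimensional ℝ Q] [MeasurableSpace Q]
  [BorelSpace Q] (μ : Measure Q) [μ.IsAddHaarMeasure] [NormedAddCommGroup C] [NormedSpace ℝ C]

theorem measure_image_snd_slice_critical_eq_zero {G : P × Q → C} {O : Set (P × Q)} (hO : IsOpen O)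
    (hG : ContDiffOn ℝ ∞ G O) :
    μ (Prod.snd '' {p ∈ O | G p = 0 ∧ (fderiv ℝ G p).range = ⊤ ∧
      (fderiv ℝ (fun u ↦ G (u, p.2)) p.1).range ≠ ⊤}) = 0 := by
  refine measure_image_null_of_locally_null ?_
  rintro p₀ ⟨hp₀, -, hsurj, -⟩
  obtain ⟨O', -, hO', hp₀O', hnull⟩ :=
    SardProperty.exists_isOpen_forall_measure_image_fiber_eq_zero μ (sardProperty _ Q) hO
      contDiff_snd.contDiffOn hG hp₀ hsurj
  refine ⟨_, inter_mem_nhdsWithin _ (hO'.mem_nhds hp₀O'),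
    measure_mono_null (image_mono ?_) (hnull 0)⟩
  rintro p ⟨⟨hp, hGp, hsurj, hcrit⟩, hpO'⟩
  refine ⟨hpO', hGp, fun hmap ↦ hcrit ?_⟩
  have hslice : HasFDerivAt (fun u ↦ G (u, p.2)) (fderiv ℝ G p ∘L .inl ℝ P Q) p.1 :=
    ((hG.contDiffAt (hO.mem_nhds hp)).differentiableAt (by simp)).hasFDerivAt.comp p.1
      (hasFDerivAt_prodMk_left p.1 p.2)
  rw [fderiv_snd] at hmap
  rw [hslice.fderiv, ContinuousLinearMap.toLinearMap_comp, LinearMap.range_comp,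
    ContinuousLinearMap.coe_inl, ← LinearMap.ker_snd]
  exact (map_ker_eq_top_comm hsurj Submodule.range_snd).1 hmap

end Parametric

section NormalCoordinate

variable {𝕜 : Type*} [NontriviallyNormedField 𝕜] {n : WithTop ℕ∞}
  {EX : Type*} [NormedAddCommGroup EX] [NormedSpace 𝕜 EX] {HX : Type*} [TopologicalSpace HX]
  {K : ModelWithCorners 𝕜 EX HX} {X : Type*} [TopologicalSpace X] [ChartedSpace HX X]
  {EN : Type*} [NormedAddCommGroup EN] [NormedSpace 𝕜 EN] {HN : Type*} [TopologicalSpace HN]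
  {J : ModelWithCorners 𝕜 EN HN} {N : Type*} [TopologicalSpace N] [ChartedSpace HN N]

theorem mdifferentiable_of_mem_maximalAtlas {e : OpenPartialHomeomorph N HN}
    (he : e ∈ IsManifold.maximalAtlas J n N) (hn : n ≠ 0) : e.MDifferentiable J J :=
  ⟨(contMDiffOn_of_mem_maximalAtlas he).mdifferentiableOn hn,
    (contMDiffOn_symm_of_mem_maximalAtlas he).mdifferentiableOn hn⟩

theorem bijective_mfderiv_extend [IsManifold J n N] {e : OpenPartialHomeomorph N HN}
    (he : e ∈ IsManifold.maximalAtlas J n N) (hn : n ≠ 0) {y : N} (hy : y ∈ e.source) :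
    Function.Bijective (mfderiv J 𝓘(𝕜, EN) (e.extend J) y) := by
  have : IsManifold J 1 N := .of_le (ENat.one_le_iff_ne_zero_withTop.2 hn)
  have hmd := mdifferentiable_of_mem_maximalAtlas he hn
  have hJ := J.hasMFDerivAt.comp y (hmd.mdifferentiableAt hy).hasMFDerivAt
  rw [show mfderiv J 𝓘(𝕜, EN) (e.extend J) y = _ from hJ.mfderiv]
  exact hmd.mfderiv_bijective hy

variable {f : X → N} {x : X}

/-- The coordinate transverse to the image of an immersion: in the charts where the immersion `f`
becomes `u ↦ (u, 0)`, this is the second component. It is a submersion near `f x`, and the image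
of `f` near `x` lies in its zero set. -/
noncomputable def normalCoordinate (h : IsImmersionAt K J n f x) (y : N) : h.complement :=
  (h.equiv.symm (h.codChart.extend J y)).2

variable (h : IsImmersionAt K J n f x)

theorem codChart_extend_apply {z : X} (hz : z ∈ h.domChart.source) :
    h.codChart.extend J (f z) = h.equiv (h.domChart.extend K z, 0) := by
  have hz' : z ∈ (h.domChart.extend K).source := by rwa [h.domChart.extend_source]
  simpa only [Function.comp_apply, PartialEquiv.left_inv _ hz'] using
    h.writtenInCharts ((h.domChart.extend K).map_source hz')

theorem normalCoordinate_eq_zero {z : X} (hz : z ∈ h.domChart.source) :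
    normalCoordinate h (f z) = 0 := by
  rw [normalCoordinate, codChart_extend_apply h hz, h.equiv.symm_apply_apply]

theorem contMDiffOn_normalCoordinate :
    ContMDiffOn J 𝓘(𝕜, h.complement) n (normalCoordinate h) h.codChart.source :=
  (contDiff_snd.comp h.equiv.symm.contDiff).contMDiff.comp_contMDiffOn
    (h.codChart.contMDiffOn_extend h.codChart_mem_maximalAtlas)

theorem mdifferentiableAt_normalCoordinate (hn : n ≠ 0) {y : N} (hy : y ∈ h.codChart.source) :
    MDifferentiableAt J 𝓘(𝕜, h.complement) (normalCoordinate h) y :=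
  ((contMDiffOn_normalCoordinate h).contMDiffAt
    (h.codChart.open_source.mem_nhds hy)).mdifferentiableAt hn

theorem mfderiv_normalCoordinate_apply (hn : n ≠ 0) {y : N} (hy : y ∈ h.codChart.source)
    (v : TangentSpace J y) :
    mfderiv J 𝓘(𝕜, h.complement) (normalCoordinate h) y v =
      (h.equiv.symm (mfderiv J 𝓘(𝕜, EN) (h.codChart.extend J) y v)).2 := by
  have hψ := ((h.codChart.contMDiffAt_extend h.codChart_mem_maximalAtlas hy).mdifferentiableAt
    hn).hasMFDerivAt
  have hsnd := (hasFDerivAt_snd.comp (h.codChart.extend J y)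
    h.equiv.symm.hasFDerivAt).hasMFDerivAt
  exact DFunLike.congr_fun (hsnd.comp y hψ).mfderiv v

theorem range_mfderiv_normalCoordinate [IsManifold J n N] (hn : n ≠ 0) {y : N}
    (hy : y ∈ h.codChart.source) :
    (mfderiv J 𝓘(𝕜, h.complement) (normalCoordinate h) y).range = ⊤ := by
  refine LinearMap.range_eq_top.2 fun c ↦ ?_
  obtain ⟨v, hv⟩ := (bijective_mfderiv_extend h.codChart_mem_maximalAtlas hn hy).2 (h.equiv (0, c))
  refine ⟨v, (mfderiv_normalCoordinate_apply h hn hy v).trans ?_⟩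
  rw [hv]
  exact congrArg Prod.snd (h.equiv.symm_apply_apply (0, c))

theorem mfderiv_codChart_extend_apply (hn : n ≠ 0) {z : X} (hz : z ∈ h.domChart.source)
    (v : TangentSpace K z) :
    mfderiv J 𝓘(𝕜, EN) (h.codChart.extend J) (f z) (mfderiv K J f z v) =
      h.equiv (mfderiv K 𝓘(𝕜, EX) (h.domChart.extend K) z v, 0) := by
  have hzs := h.domChart.open_source.mem_nhds hz
  have hf := ((h.contMDiffOn.contMDiffAt hzs).mdifferentiableAt hn).hasMFDerivAt
  have hφ := ((h.domChart.contMDiffAt_extend h.domChart_mem_maximalAtlas hz).mdifferentiableAt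
    hn).hasMFDerivAt
  have hψ := ((h.codChart.contMDiffAt_extend h.codChart_mem_maximalAtlas
    (h.source_subset_preimage_source hz)).mdifferentiableAt hn).hasMFDerivAt
  have hinl := (h.equiv.hasFDerivAt.comp _
    (hasFDerivAt_prodMk_left (h.domChart.extend K z) 0)).hasMFDerivAt
  exact DFunLike.congr_fun (hasMFDerivAt_unique (hψ.comp z hf)
    ((hinl.comp z hφ).congr_of_eventuallyEq
      (Filter.mem_of_superset hzs fun _ ↦ codChart_extend_apply h))) v

theorem ker_mfderiv_normalCoordinate [IsManifold K n X] [IsManifold J n N] (hn : n ≠ 0)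
    {z : X} (hz : z ∈ h.domChart.source) :
    (mfderiv J 𝓘(𝕜, h.complement) (normalCoordinate h) (f z)).ker = (mfderiv K J f z).range := by
  have hy : f z ∈ h.codChart.source := h.source_subset_preimage_source hz
  ext v
  rw [LinearMap.mem_ker]
  constructor
  · intro hv
    obtain ⟨u, hu⟩ := (bijective_mfderiv_extend h.domChart_mem_maximalAtlas hn hz).2
      (h.equiv.symm (mfderiv J 𝓘(𝕜, EN) (h.codChart.extend J) (f z) v)).1
    refine ⟨u, (bijective_mfderiv_extend h.codChart_mem_maximalAtlas hn hy).1 ?_⟩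
    refine (mfderiv_codChart_extend_apply h hn hz u).trans (h.equiv.symm.injective ?_)
    rw [h.equiv.symm_apply_apply, hu]
    exact Prod.ext rfl ((mfderiv_normalCoordinate_apply h hn hy v).symm.trans hv).symm
  · rintro ⟨u, rfl⟩
    refine (mfderiv_normalCoordinate_apply h hn hy _).trans ?_
    refine (congrArg (fun c ↦ (h.equiv.symm c).2)
      (mfderiv_codChart_extend_apply h hn hz u)).trans ?_
    exact congrArg Prod.snd (h.equiv.symm_apply_apply _)

end NormalCoordinate

section Transverse

variable {EX : Type*} [NormedAddCommGroup EX] [NormedSpace ℝ EX] {HX : Type*} [TopologicalSpace HX]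
  {I : ModelWithCorners ℝ EX HX} {X : Type*} [TopologicalSpace X] [ChartedSpace HX X]
  {EN : Type*} [NormedAddCommGroup EN] [NormedSpace ℝ EN] {HN : Type*} [TopologicalSpace HN]
  {J : ModelWithCorners ℝ EN HN} {N : Type*} [TopologicalSpace N] [ChartedSpace HN N]
  {ES : Type*} [NormedAddCommGroup ES] [NormedSpace ℝ ES] {HS : Type*} [TopologicalSpace HS]
  {K : ModelWithCorners ℝ ES HS} {S : Set N} [ChartedSpace HS S] {f : X → N} {x : X}

theorem isTransverseAt_iff_range_mfderiv_comp {C : Type*} [NormedAddCommGroup C]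
    [NormedSpace ℝ C] {q : N → C} (hf : MDifferentiableAt I J f x) (hx : f x ∈ S)
    (hq : MDifferentiableAt J 𝓘(ℝ, C) q (f x)) (hrange : (mfderiv J 𝓘(ℝ, C) q (f x)).range = ⊤)
    (hker : (mfderiv J 𝓘(ℝ, C) q (f x)).ker = tangentSubspace J K S ⟨f x, hx⟩) :
    IsTransverseAt I J K f S x ↔ (mfderiv I 𝓘(ℝ, C) (q ∘ f) x).range = ⊤ := by
  rw [mfderiv_comp x hq hf]
  refine Iff.trans ?_ ((map_eq_top_iff_sup_ker_eq_top hrange).symm.trans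
    (Eq.congr_left (LinearMap.range_comp _ _).symm))
  rw [hker, sup_comm]
  exact ⟨fun h ↦ h hx, fun h _ ↦ h⟩

theorem isTransverseAt_comp_iff {EY : Type*} [NormedAddCommGroup EY] [NormedSpace ℝ EY]
    {HY : Type*} [TopologicalSpace HY] {I' : ModelWithCorners ℝ EY HY} {Y : Type*}
    [TopologicalSpace Y] [ChartedSpace HY Y] {g : Y → X} {y : Y}
    (hf : MDifferentiableAt I J f (g y)) (hg : MDifferentiableAt I' I g y)
    (hsurj : Function.Surjective (mfderiv I' I g y)) :
    IsTransverseAt I' J K (f ∘ g) S y ↔ IsTransverseAt I J K f S (g y) := by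
  have hrange : (mfderiv I' J (f ∘ g) y).range = (mfderiv I J f (g y)).range := by
    rw [mfderiv_comp y hf hg]
    exact LinearMap.range_comp_of_range_eq_top _ (LinearMap.range_eq_top.2 hsurj)
  exact forall_congr' fun _ ↦ by rw [hrange]; rfl

section VectorSpace

variable {P Q : Type*} [NormedAddCommGroup P] [NormedSpace ℝ P] [FiniteDimensional ℝ P]
  [NormedAddCommGroup Q] [NormedSpace ℝ Q] [FiniteDimensional ℝ Q] [MeasurableSpace Q]
  [BorelSpace Q] (μ : Measure Q) [μ.IsAddHaarMeasure] [IsManifold J ∞ N] [IsManifold K ∞ S]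

theorem measure_image_snd_slice_not_isTransverseAt_eq_zero
    (hS : IsImmersion K J ∞ (Subtype.val : S → N)) {F : P × Q → N} {O : Set (P × Q)}
    (hO : IsOpen O) (hF : ContMDiffOn 𝓘(ℝ, P × Q) J ∞ F O)
    (hFS : ∀ z ∈ O, IsTransverseAt 𝓘(ℝ, P × Q) J K F S z) :
    μ (Prod.snd '' {z ∈ O | ¬ IsTransverseAt 𝓘(ℝ, P) J K (fun u ↦ F (u, z.2)) S z.1}) = 0 := by
  refine measure_image_null_of_locally_null ?_
  rintro z₀ ⟨hz₀, hbad⟩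
  obtain ⟨hz₀S, -⟩ := not_forall.1 hbad
  have h := hS.isImmersionAt ⟨F z₀, hz₀S⟩
  obtain ⟨W, hW, hWφ⟩ := isOpen_induced_iff.1 h.domChart.open_source
  set O' := O ∩ F ⁻¹' (W ∩ h.codChart.source)
  have hO' : IsOpen O' :=
    hF.continuousOn.isOpen_inter_preimage hO (hW.inter h.codChart.open_source)
  have hz₀O' : z₀ ∈ O' := ⟨hz₀, hWφ.superset h.mem_domChart_source, h.mem_codChart_source⟩
  have hG : ContDiffOn ℝ ∞ (normalCoordinate h ∘ F) O' := contMDiffOn_iff_contDiffOn.1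
    ((contMDiffOn_normalCoordinate h).comp (hF.mono inter_subset_left) fun z hz ↦ hz.2.2)
  refine ⟨_, inter_mem_nhdsWithin _ (hO'.mem_nhds hz₀O'), measure_mono_null (image_mono ?_)
    (measure_image_snd_slice_critical_eq_zero μ hO' hG)⟩
  rintro z ⟨⟨hz, hbad⟩, hzO'⟩
  obtain ⟨hzS, -⟩ := not_forall.1 hbad
  have hzφ : (⟨F z, hzS⟩ : S) ∈ h.domChart.source := hWφ.subset hzO'.2.1
  have hFz : MDifferentiableAt 𝓘(ℝ, P × Q) J F z :=
    (hF.contMDiffAt (hO.mem_nhds hz)).mdifferentiableAt (by simp)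
  have hslice : MDifferentiableAt 𝓘(ℝ, P) J (fun u ↦ F (u, z.2)) z.1 :=
    MDifferentiableAt.comp z.1 (g := F) hFz
      (hasFDerivAt_prodMk_left z.1 z.2).differentiableAt.mdifferentiableAt
  have hq := mdifferentiableAt_normalCoordinate h (by simp) hzO'.2.2
  have hrange := range_mfderiv_normalCoordinate h (by simp) hzO'.2.2
  have hker := ker_mfderiv_normalCoordinate h (by simp) hzφ
  refine ⟨hzO', normalCoordinate_eq_zero h hzφ, ?_, fun hcrit ↦ hbad ?_⟩
  · rw [← mfderiv_eq_fderiv]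
    exact (isTransverseAt_iff_range_mfderiv_comp hFz hzS hq hrange hker).1 (hFS z hz)
  · rw [← mfderiv_eq_fderiv] at hcrit
    exact (isTransverseAt_iff_range_mfderiv_comp hslice hzS hq hrange hker).2 hcrit

end VectorSpace

end Transverse

section ExtChart

variable {𝕜 : Type*} [NontriviallyNormedField 𝕜] {E : Type*} [NormedAddCommGroup E]
  [NormedSpace 𝕜 E] {H : Type*} [TopologicalSpace H] {I : ModelWithCorners 𝕜 E H}
  [I.Boundaryless] {M : Type*} [TopologicalSpace M] [ChartedSpace H M] [IsManifold I 1 M]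

theorem mdifferentiableAt_extChartAt_symm {x : M} {u : E} (hu : u ∈ (extChartAt I x).target) :
    MDifferentiableAt 𝓘(𝕜, E) I (extChartAt I x).symm u := by
  simpa only [I.range_eq_univ, mdifferentiableWithinAt_univ] using
    mdifferentiableWithinAt_extChartAt_symm hu

theorem surjective_mfderiv_extChartAt_symm {x : M} {u : E} (hu : u ∈ (extChartAt I x).target) :
    Function.Surjective (mfderiv 𝓘(𝕜, E) I (extChartAt I x).symm u) := by
  have h := isInvertible_mfderivWithin_extChartAt_symm hu
  rw [I.range_eq_univ, mfderivWithin_univ] at h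
  exact h.bijective.surjective

end ExtChart

section ChartFamily

variable {EM : Type*} [NormedAddCommGroup EM] [NormedSpace ℝ EM] {HM : Type*} [TopologicalSpace HM]
  {I : ModelWithCorners ℝ EM HM} [I.Boundaryless] {M : Type*} [TopologicalSpace M]
  [ChartedSpace HM M] [IsManifold I ∞ M]
  {EN : Type*} [NormedAddCommGroup EN] [NormedSpace ℝ EN] {HN : Type*} [TopologicalSpace HN]
  {J : ModelWithCorners ℝ EN HN} {N : Type*} [TopologicalSpace N] [ChartedSpace HN N]
  {ES : Type*} [NormedAddCommGroup ES] [NormedSpace ℝ ES] {HS : Type*} [TopologicalSpace HS]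
  {K : ModelWithCorners ℝ ES HS} {S : Set N} [ChartedSpace HS S]
  {Q : Type*} [NormedAddCommGroup Q] [NormedSpace ℝ Q]
  {T : Type*} [TopologicalSpace T] [ChartedSpace Q T]

theorem isTransverseAt_prodMap_chart_symm {F : M × T → N}
    (hF : ContMDiff (I.prod 𝓘(ℝ, Q)) J ∞ F) (hFS : IsTransverse (I.prod 𝓘(ℝ, Q)) J K F S) (x : M)
    {e : OpenPartialHomeomorph T Q} (he : e ∈ IsManifold.maximalAtlas 𝓘(ℝ, Q) ∞ T) {z : EM × Q}
    (hz : z ∈ (extChartAt I x).target ×ˢ e.target) :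
    IsTransverseAt 𝓘(ℝ, EM × Q) J K (F ∘ Prod.map (extChartAt I x).symm e.symm) S z := by
  have hmd := mdifferentiable_of_mem_maximalAtlas he (by simp)
  have hx := mdifferentiableAt_extChartAt_symm hz.1
  have ht := hmd.mdifferentiableAt_symm hz.2
  rw [modelWithCornersSelf_prod, ← chartedSpaceSelf_prod]
  refine (isTransverseAt_comp_iff ((hF _).mdifferentiableAt (by simp)) (hx.prodMap ht) ?_).2 (hFS _)
  rw [mfderiv_prodMap hx ht]
  exact (surjective_mfderiv_extChartAt_symm hz.1).prodMap (hmd.symm.mfderiv_surjective hz.2)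

theorem measure_image_chart_not_isTransverseAt_eq_zero [FiniteDimensional ℝ EM]
    [FiniteDimensional ℝ Q] [MeasurableSpace Q] [BorelSpace Q] (μ : Measure Q) [μ.IsAddHaarMeasure]
    [IsManifold J ∞ N] [IsManifold K ∞ S] (hS : IsImmersion K J ∞ (Subtype.val : S → N))
    {F : M × T → N} (hF : ContMDiff (I.prod 𝓘(ℝ, Q)) J ∞ F)
    (hFS : IsTransverse (I.prod 𝓘(ℝ, Q)) J K F S) (x₀ : M) {e : OpenPartialHomeomorph T Q}
    (he : e ∈ IsManifold.maximalAtlas 𝓘(ℝ, Q) ∞ T) :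
    μ (e '' {t ∈ e.source | ∃ x ∈ (extChartAt I x₀).source,
      ¬ IsTransverseAt I J K (fun x ↦ F (x, t)) S x}) = 0 := by
  have hcharts : ContMDiffOn 𝓘(ℝ, EM × Q) (I.prod 𝓘(ℝ, Q)) ∞
      (Prod.map (extChartAt I x₀).symm e.symm) ((extChartAt I x₀).target ×ˢ e.target) := by
    rw [modelWithCornersSelf_prod, ← chartedSpaceSelf_prod]
    exact (contMDiffOn_extChartAt_symm x₀).prodMap (contMDiffOn_symm_of_mem_maximalAtlas he)
  refine measure_mono_null ?_ (measure_image_snd_slice_not_isTransverseAt_eq_zero μ hS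
    ((isOpen_extChartAt_target x₀).prod e.open_target) (hF.comp_contMDiffOn hcharts)
    fun z hz ↦ isTransverseAt_prodMap_chart_symm hF hFS x₀ he hz)
  rintro _ ⟨t, ⟨ht, x, hx, hbad⟩, rfl⟩
  have hxt := (extChartAt I x₀).map_source hx
  refine ⟨(extChartAt I x₀ x, e t), ⟨⟨hxt, e.map_source ht⟩, ?_⟩, rfl⟩
  simp only [Function.comp_apply, Prod.map_apply, e.left_inv ht]
  rw [← (extChartAt I x₀).left_inv hx] at hbad
  exact mt (isTransverseAt_comp_iff (g := (extChartAt I x₀).symm)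
    ((hF.comp (contMDiff_id.prodMk contMDiff_const) _).mdifferentiableAt (by simp))
    (mdifferentiableAt_extChartAt_symm hxt) (surjective_mfderiv_extChartAt_symm hxt)).1 hbad

end ChartFamily

end Transversality

theorem mainTheorem2_general {k : ℕ}
    {EM : Type*} [NormedAddCommGroup EM] [NormedSpace ℝ EM] [FiniteDimensional ℝ EM]
    {HM : Type*} [TopologicalSpace HM] {I : ModelWithCorners ℝ EM HM} [I.Boundaryless]
    {M : Type*} [TopologicalSpace M] [SecondCountableTopology M] [ChartedSpace HM M]
    [IsManifold I ∞ M]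
    {EN : Type*} [NormedAddCommGroup EN] [NormedSpace ℝ EN] {HN : Type*} [TopologicalSpace HN]
    {J : ModelWithCorners ℝ EN HN} {N : Type*} [TopologicalSpace N] [ChartedSpace HN N]
    [IsManifold J ∞ N]
    {T : Type*} [TopologicalSpace T] [ChartedSpace (EuclideanSpace ℝ (Fin k)) T]
    {ES : Type*} [NormedAddCommGroup ES] [NormedSpace ℝ ES] {HS : Type*} [TopologicalSpace HS]
    {K : ModelWithCorners ℝ ES HS} (S : Set N) [ChartedSpace HS S] [IsManifold K ∞ S]
    (hS : Manifold.IsImmersion K J ∞ (Subtype.val : S → N))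
    (F : M × T → N) (hF : ContMDiff (I.prod (𝓡 k)) J ∞ F)
    (hFS : Transversality.IsTransverse (I.prod (𝓡 k)) J K F S) :
    Transversality.ForAlmostEvery k
      fun t : T ↦ Transversality.IsTransverse I J K (fun x : M ↦ F (x, t)) S := by
  intro e he
  obtain ⟨s, hs, hcover⟩ := TopologicalSpace.countable_cover_nhds
    fun x : M ↦ extChartAt_source_mem_nhds (I := I) x
  refine MeasureTheory.measure_mono_null (t := ⋃ x₀ ∈ s, _) ?_
    ((MeasureTheory.measure_biUnion_null_iff hs).2 fun x₀ _ ↦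
      Transversality.measure_image_chart_not_isTransverseAt_eq_zero MeasureTheory.volume hS hF hFS
        x₀ he)
  rintro _ ⟨t, ⟨ht, hbad⟩, rfl⟩
  obtain ⟨x, hx⟩ := not_forall.1 hbad
  obtain ⟨x₀, hx₀, hxx₀⟩ := Set.mem_iUnion₂.1 (hcover.superset (Set.mem_univ x))
  exact Set.mem_iUnion₂.2 ⟨x₀, hx₀, t, ⟨ht, x, hxx₀, hx⟩, rfl⟩

theorem mainTheorem2 {m n k d : ℕ}
    {M : Type*} [TopologicalSpace M] [T2Space M] [SecondCountableTopology M]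
    [ChartedSpace (EuclideanSpace ℝ (Fin m)) M] [IsManifold (𝓡 m) ∞ M]
    {N : Type*} [TopologicalSpace N] [T2Space N] [SecondCountableTopology N]
    [ChartedSpace (EuclideanSpace ℝ (Fin n)) N] [IsManifold (𝓡 n) ∞ N]
    {T : Type*} [TopologicalSpace T] [T2Space T] [SecondCountableTopology T]
    [ChartedSpace (EuclideanSpace ℝ (Fin k)) T] [IsManifold (𝓡 k) ∞ T]
    -- `S` is an embedded smooth submanifold of `N` of dimension `d`
    (S : Set N) [ChartedSpace (EuclideanSpace ℝ (Fin d)) S] [IsManifold (𝓡 d) ∞ S]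
    (hS : Manifold.IsSmoothEmbedding (𝓡 d) (𝓡 n) ∞ (Subtype.val : S → N))
    (F : M × T → N) (hF : ContMDiff ((𝓡 m).prod (𝓡 k)) (𝓡 n) ∞ F)
    (hFS : Transversality.IsTransverse ((𝓡 m).prod (𝓡 k)) (𝓡 n) (𝓡 d) F S) :
    Transversality.ForAlmostEvery k
      (fun t : T => Transversality.IsTransverse (𝓡 m) (𝓡 n) (𝓡 d) (fun x : M => F (x, t)) S) :=
  mainTheorem2_general S hS.isImmersion F hF hFS
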